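/- **Setting.** An \emph{mm-space} is a triple $X=(X,d_X,\mu_X)$ of a complete separable metric space and a Borel probability measure $\mu_X$ with $\operatorname{supp}\mu_X=X$; two mm-spaces are \emph{mm-isomorphic} if there is a surjective isometry $X\to Y$ pushing $\mu_X$ forward to $\mu_Y$, and $\mathcal X$ is the set of mm-isomorphism classes. If $\mu$ is a Borel probability measure on a complete separable metric space $E$ that need not have full support, $(E,\mu)$ denotes the mm-space $\operatorname{supp}\mu$ with the restricted metric and measure. Write $Y\prec X$ if there is a $1$-Lipschitz map $f:X\to Y$ with $f_*\mu_X=\mu_Y$. Let $I=[0,1)$ with Lebesgue measure $\mathcal L^1$. A \emph{parameter} of $X$ is a Borel map $\varphi:I\to X$ with $\varphi_*\mathcal L^1=\mu_X$. The \emph{box distance} $\square(X,Y)$ is the infimum of the $\varepsilon\ge 0$ for which there are parameters $\varphi$ of $X$ and $\psi$ of $Y$ and a Borel set $I_0\subset I$ with $\mathcal L^1(I_0)\ge 1-\varepsilon$ and $|d_X(\varphi(s),\varphi(t))-d_Y(\psi(s),\psi(t))|\le\varepsilon$ for all $s,t\in I_0$; for $\mathcal P\subset\mathcal X$ put $\square(X,\mathcal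 P)=\inf_{Y\in\mathcal P}\square(X,Y)$. For measurable $f,g:I\to\mathbb R$ let $\mathrm{me}(f,g)=\inf\{\varepsilon\ge0 : \mathcal L^1(\{|f-g|>\varepsilon\})\le\varepsilon\}$. The \emph{observable distance} is $$d_{\mathrm{conc}}(X,Y)=\inf_{\varphi,\psi} d_H\bigl(\{f\circ\varphi : f:X\to\mathbb R\ 1\text{-Lipschitz}\},\{g\circ\psi : g:Y\to\mathbb R\ 1\text{-Lipschitz}\}\bigr),$$ where $\varphi,\psi$ run over the parameters of $X$ and $Y$ and $d_H$ is the Hausdorff distance with respect to $\mathrm{me}$. A \emph{pyramid} is a nonempty $\square$-closed set $\mathcal P\subset\mathcal X$ such that $X\in\mathcal P$ and $Y\prec X$ imply $Y\in\mathcal P$, and such that for all $X,X'\in\mathcal P$ there is $Y\in\mathcal P$ with $X\prec Y$ and $X'\prec Y$. Let $\Pi$ be the set of pyramids. For an mm-space $X$ let $\mathcal P_X=\{X'\in\mathcal X : X'\prec X\}$. A sequence $\mathcal P_n\in\Pi$ \emph{converges weakly} to $\mathcal P\in\Pi$ if $\lim_n\square(X,\mathcal P_n)=0$ for every $X\in\mathcal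 P$ and $\liminf_n\square(X,\mathcal P_n)>0$ for every $X\in\mathcal X\setminus\mathcal P$. For a natural number $N$ and a real number $R\ge0$ let $\mathcal M(\mathcal P;N,R)$ be the set of Borel probability measures $\mu$ on $\mathbb R^N$ with $\operatorname{supp}\mu\subset\{x : \|x\|_\infty\le R\}$ and $(\mathbb R^N,\|\cdot\|_\infty,\mu)\in\mathcal P$, and for these sets let $d_H$ be the Hausdorff distance with respect to the Prokhorov metric for $\|\cdot\|_\infty$. For $R>0$ put $$\rho_R(\mathcal P,\mathcal P')=\sum_{N=1}^\infty\frac{1}{N\,2^{N+1}}\,d_H\bigl(\mathcal M(\mathcal P;N,NR),\mathcal M(\mathcal P';N,NR)\bigr).$$ **Theorem.** 1. For each $R>0$, the series defining $\rho_R$ converges on $\Pi\times\Pi$, and $\rho_R$ is a metric on $\Pi$ compatible with weak convergence: a sequence of pyramids $\mathcal P_n$ converges to a pyramid $\mathcal P$ with respect to $\rho_R$ if and only if $\mathcal P_n$ converges weakly to $\mathcal P$. 2. For any pyramids $\mathcal P,\mathcal P'$, any natural number $N$ and any real number $R>0$, $$d_H\bigl(\mathcal M(\mathcal P;N,NR),\mathcal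 M(\mathcal P';N,NR)\bigr)\le N\,2^{N+1}\rho_R(\mathcal P,\mathcal P').$$ 3. For any mm-spaces $X,Y$ and any real number $R>0$, $\rho_R(\mathcal P_X,\mathcal P_Y)\le d_{\mathrm{conc}}(X,Y)$. -/

import Mathlib

open MeasureTheory Filter Topology
open scoped ENNReal

noncomputable section

namespace MM

/-- An mm-space: a complete separable metric space with a Borel probability measure whose
support is the whole space. -/
structure MMSpace where
  /-- the underlying set; every separable metric space has at most continuum many points, so that
  nothing is lost by taking it in `Type` -/
  carrier : Type
  [metric : MetricSpace carrier]
  [complete : CompleteSpace carrier]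
  [separable : TopologicalSpace.SeparableSpace carrier]
  [measurable : MeasurableSpace carrier]
  [borel : BorelSpace carrier]
  /-- the measure of the mm-space -/
  meas : Measure carrier
  [prob : IsProbabilityMeasure meas]
  support_eq : meas.support = Set.univ

instance : CoeSort MMSpace Type := ⟨MMSpace.carrier⟩

attribute [instance] MMSpace.metric MMSpace.complete MMSpace.separable MMSpace.measurable
  MMSpace.borel MMSpace.prob

/-- Two mm-spaces are mm-isomorphic if there is a measure preserving isometry between them. -/
def MMIso (X Y : MMSpace) : Prop :=
  ∃ e : X ≃ᵢ Y, X.meas.map e = Y.meas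

theorem MMIso.refl (X : MMSpace) : MMIso X X :=
  ⟨IsometryEquiv.refl X, Measure.map_id⟩

theorem MMIso.symm {X Y : MMSpace} (h : MMIso X Y) : MMIso Y X := by
  obtain ⟨e, he⟩ := h
  refine ⟨e.symm, ?_⟩
  rw [← he, Measure.map_map e.symm.continuous.measurable e.continuous.measurable]
  have : (⇑e.symm ∘ ⇑e) = id := by
    funext x
    simp
  rw [this, Measure.map_id]

theorem MMIso.trans {X Y Z : MMSpace} (h : MMIso X Y) (h' : MMIso Y Z) : MMIso X Z := by
  obtain ⟨e, he⟩ := h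
  obtain ⟨f, hf⟩ := h'
  refine ⟨e.trans f, ?_⟩
  rw [← hf, ← he, Measure.map_map f.continuous.measurable e.continuous.measurable]
  rfl

instance mmSetoid : Setoid MMSpace where
  r := MMIso
  iseqv := ⟨MMIso.refl, MMIso.symm, MMIso.trans⟩

/-- The set of mm-isomorphism classes of mm-spaces. -/
def MMClass : Type 1 := Quotient mmSetoid

/-- The mm-isomorphism class of an mm-space. -/
def MMSpace.cls (X : MMSpace) : MMClass := Quotient.mk mmSetoid X

/-- `Dominated Y X` is the Lipschitz order `Y ≺ X`: there is a `1`-Lipschitz map `X → Y` that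
pushes the measure of `X` forward to that of `Y`. -/
def Dominated (Y X : MMSpace) : Prop :=
  ∃ f : X → Y, LipschitzWith 1 f ∧ X.meas.map f = Y.meas

theorem MMIso.dominated {X Y : MMSpace} (h : MMIso X Y) : Dominated Y X := by
  obtain ⟨e, he⟩ := h
  exact ⟨e, e.isometry.lipschitz, he⟩

theorem Dominated.trans {X Y Z : MMSpace} (h : Dominated X Y) (h' : Dominated Y Z) :
    Dominated X Z := by
  obtain ⟨f, hf, hfm⟩ := h
  obtain ⟨g, hg, hgm⟩ := h'
  refine ⟨f ∘ g, ?_, ?_⟩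
  · simpa using hf.comp hg
  · rw [← hfm, ← hgm, Measure.map_map hf.continuous.measurable hg.continuous.measurable]

/-- The Lipschitz order on mm-isomorphism classes. -/
def MMClass.Prec : MMClass → MMClass → Prop :=
  Quotient.lift₂ Dominated fun _ _ _ _ h₁ h₂ =>
    propext ⟨fun h => (h₁.dominated.trans h).trans h₂.symm.dominated,
      fun h => (h₁.symm.dominated.trans h).trans h₂.dominated⟩

/-- The interval `[0,1)`. -/
abbrev I : Type := Set.Ico (0 : ℝ) 1

/-- The Lebesgue measure on `[0,1)`. -/
def leb : Measure I := (volume : Measure ℝ).comap Subtype.val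

/-- A parameter of an mm-space. -/
def IsParameter (X : MMSpace) (φ : I → X) : Prop :=
  Measurable φ ∧ leb.map φ = X.meas

/-- The box distance of two mm-spaces. -/
def box (X Y : MMSpace) : ℝ≥0∞ :=
  sInf {ε : ℝ≥0∞ | ∃ (φ : I → X) (ψ : I → Y) (I₀ : Set I),
    IsParameter X φ ∧ IsParameter Y ψ ∧ MeasurableSet I₀ ∧
    (∀ s ∈ I₀, ∀ t ∈ I₀, ENNReal.ofReal |dist (φ s) (φ t) - dist (ψ s) (ψ t)| ≤ ε) ∧
    1 - ε ≤ leb I₀}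

theorem IsParameter.comp {X Y : MMSpace} {φ : I → X} (hφ : IsParameter X φ) (e : X ≃ᵢ Y)
    (he : X.meas.map e = Y.meas) : IsParameter Y (e ∘ φ) :=
  ⟨e.continuous.measurable.comp hφ.1, by
    rw [← Measure.map_map e.continuous.measurable hφ.1, hφ.2, he]⟩

theorem box_le_of_mmIso {X X' Y Y' : MMSpace} (h : MMIso X X') (h' : MMIso Y Y') :
    box X' Y' ≤ box X Y := by
  obtain ⟨e, he⟩ := h
  obtain ⟨e', he'⟩ := h'
  refine sInf_le_sInf ?_
  rintro ε ⟨φ, ψ, I₀, hφ, hψ, hI, hd, hv⟩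
  refine ⟨e ∘ φ, e' ∘ ψ, I₀, hφ.comp e he, hψ.comp e' he', hI, fun s hs t ht => ?_, hv⟩
  rw [Function.comp_apply, Function.comp_apply, Function.comp_apply, Function.comp_apply,
    e.dist_eq, e'.dist_eq]
  exact hd s hs t ht

/-- The box distance on mm-isomorphism classes. -/
def MMClass.box : MMClass → MMClass → ℝ≥0∞ :=
  Quotient.lift₂ MM.box fun _ _ _ _ h₁ h₂ =>
    le_antisymm (box_le_of_mmIso h₁.symm h₂.symm) (box_le_of_mmIso h₁ h₂)

/-- The box distance from a point to a set of mm-isomorphism classes. -/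
def boxTo (x : MMClass) (P : Set MMClass) : ℝ≥0∞ := ⨅ y ∈ P, x.box y

/-- The conditions that make a set of mm-isomorphism classes a pyramid. -/
structure IsPyramid (P : Set MMClass) : Prop where
  lower : ∀ x ∈ P, ∀ y : MMClass, y.Prec x → y ∈ P
  directed : ∀ x ∈ P, ∀ x' ∈ P, ∃ y ∈ P, x.Prec y ∧ x'.Prec y
  nonempty : P.Nonempty
  closed : ∀ x : MMClass, boxTo x P = 0 → x ∈ P

/-- The set of all pyramids. -/
def Pyramid : Type 1 := {P : Set MMClass // IsPyramid P}

/-- The pyramid associated with an mm-space `X`: all classes dominated by that of `X`. -/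
def assoc (X : MMSpace) : Set MMClass := {x | x.Prec X.cls}

/-- Weak convergence of a sequence of pyramids. -/
def ConvergesWeakly (Ps : ℕ → Pyramid) (P : Pyramid) : Prop :=
  (∀ x ∈ P.1, Tendsto (fun n => boxTo x (Ps n).1) atTop (𝓝 0)) ∧
  (∀ x ∉ P.1, 0 < liminf (fun n => boxTo x (Ps n).1) atTop)

section ofMeasure

variable {E : Type} [MetricSpace E] [MeasurableSpace E] [BorelSpace E]

theorem comap_support_apply (μ : Measure E) (s : Set μ.support) :
    μ.comap (Subtype.val : μ.support → E) s = μ (Subtype.val '' s) :=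
  comap_subtype_coe_apply Measure.isClosed_support.measurableSet μ s

/-- The mm-space `(E, d, μ)`, for a Borel probability measure `μ` on a complete separable metric
space `E` that need not have full support: the support of `μ` with the restricted metric and
measure. -/
def ofMeasure [CompleteSpace E] [SecondCountableTopology E] (μ : Measure E) [IsProbabilityMeasure μ] : MMSpace :=
  haveI : CompleteSpace μ.support := Measure.isClosed_support.completeSpace_coe
  haveI : IsProbabilityMeasure (μ.comap (Subtype.val : μ.support → E)) := ⟨by
    rw [comap_support_apply, Set.image_univ, Subtype.range_coe]
    exact (prob_compl_eq_zero_iff Measure.isClosed_support.measurableSet).1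
      Measure.measure_compl_support⟩
  { carrier := μ.support
    meas := μ.comap Subtype.val
    support_eq := by
      ext x
      simp only [Set.mem_univ, iff_true, Measure.mem_support_iff_forall]
      intro U hU
      obtain ⟨V, hV, hVU⟩ := mem_nhds_subtype _ _ _ |>.1 hU
      have h1 : 0 < μ V := (Measure.mem_support_iff_forall _).1 x.2 V hV
      have h2 : μ (V ∩ μ.support) = μ V :=
        measure_inter_conull Measure.measure_compl_support
      rw [comap_support_apply]
      refine (h2.symm ▸ h1).trans_le (measure_mono ?_)
      rintro y ⟨hy, hys⟩
      exact ⟨⟨y, hys⟩, hVU hy, rfl⟩ }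

end ofMeasure

/-- The Borel probability measures on `ℝ^N`, with the Prokhorov metric; the metric of `ℝ^N`, written
`Fin N → ℝ`, is that of the sup norm. -/
abbrev ProbOn (N : ℕ) : Type := LevyProkhorov (ProbabilityMeasure (Fin N → ℝ))

/-- The measures in `ProbOn N` whose support lies in the ball of radius `R` of the sup norm. -/
def ballMeasures (N : ℕ) (R : ℝ) : Set (ProbOn N) :=
  {μ | (μ.toMeasure : Measure (Fin N → ℝ)).support ⊆ {x | ‖x‖ ≤ R}}

/-- The `N`-measurement of a pyramid. -/
def measurement (P : Set MMClass) (N : ℕ) : Set (ProbOn N) :=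
  {μ | (ofMeasure (μ.toMeasure : Measure (Fin N → ℝ))).cls ∈ P}

/-- The `(N,R)`-measurement of a pyramid. -/
def measurementBall (P : Set MMClass) (N : ℕ) (R : ℝ) : Set (ProbOn N) :=
  measurement P N ∩ ballMeasures N R

/-- The Hausdorff distance, for the Prokhorov metric, of the `(N,R)`-measurements. -/
def measurementDist (P P' : Set MMClass) (N : ℕ) (R : ℝ) : ℝ :=
  Metric.hausdorffDist (measurementBall P N R) (measurementBall P' N R)

/-- The term with index `N` of the series that defines `rho`. -/
def rhoTerm (R : ℝ) (P P' : Set MMClass) (N : ℕ) : ℝ :=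
  1 / ((N : ℝ) * 2 ^ (N + 1)) * measurementDist P P' N (N * R)

/-- `ρ_R`, the sum of the terms over `N = 1, 2, …`. -/
def rho (R : ℝ) (P P' : Set MMClass) : ℝ :=
  ∑' n : ℕ, rhoTerm R P P' (n + 1)

/-- The distance `me` of two functions on `[0,1)` for the Lebesgue measure. -/
def me (f g : I → ℝ) : ℝ≥0∞ :=
  sInf {ε : ℝ≥0∞ | leb {s | ε < ENNReal.ofReal |f s - g s|} ≤ ε}

/-- The Hausdorff distance of two sets with respect to a distance function `d`. -/
def hausdorffOf {α : Type*} (d : α → α → ℝ≥0∞) (A B : Set α) : ℝ≥0∞ :=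
  max (⨆ a ∈ A, ⨅ b ∈ B, d a b) (⨆ b ∈ B, ⨅ a ∈ A, d a b)

/-- The set of all `f ∘ φ` with `f` a real `1`-Lipschitz function on `X`. -/
def pullbackLip {X : MMSpace} (φ : I → X) : Set (I → ℝ) :=
  {g | ∃ f : X → ℝ, LipschitzWith 1 f ∧ g = f ∘ φ}

/-- The observable distance of two mm-spaces. -/
def dconc (X Y : MMSpace) : ℝ≥0∞ :=
  ⨅ (φ : I → X) (_ : IsParameter X φ) (ψ : I → Y) (_ : IsParameter Y ψ),
    hausdorffOf me (pullbackLip φ) (pullbackLip ψ)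

end MM

end

/-!
The argument rests on two transfer principles between the box distance of mm-spaces and the
Prokhorov distance of laws of `1`-Lipschitz maps to `ℝ^N`. The box distance is always used with a
fixed mm-space on the left, so that neither its symmetry nor its triangle inequality is needed.

* *From laws to spaces* (`eventually_box_ofMeasure_le`). If `F : X → E` nearly preserves distances
  on a set of almost full measure and measures `ν n` converge weakly to the law of `F`, then `X` is
  eventually box-close to `(E, ν n)`. One cuts `E` into small pieces with null boundary; by the
  portmanteau theorem the masses of corresponding pieces of `X` and of `(E, ν n)` nearly agree, and
  matching the pieces gives a coupling, hence a pair of parameters. With `F` the inclusion of a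
  support this shows that measurements of a pyramid are closed (`isClosed_measurement`); with `F`
  made of truncated distance functions (`exists_lipschitz_almost_isometry`) it shows that an
  mm-space lies in a pyramid as soon as the laws of its bounded `1`-Lipschitz maps are measurements
  of the pyramid (`cls_mem_of_law_mem`). Hence `ρ_R` separates pyramids.
* *From spaces to laws* (`exists_law_near_of_box_lt`). If `Y` is box-close to `X`, McShane's formula
  carries a bounded `1`-Lipschitz map on `X` to one on `Y` with nearly the same law.

By dominated convergence, `ρ_R`-convergence is the convergence of every measurement in the
Hausdorff distance (`tendsto_rho_iff`). That this is weak convergence (`convergesWeakly_iff`)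
follows from the two principles and the compactness of the set of probability measures on a closed
ball, which makes the pointwise approximation of measurements uniform.

For the bound by the observable distance, each of the `N` coordinates of a map on `X` is replaced
by a function on `Y` that is close to it in `me`; the union bound loses a factor `N`
(`exists_law_near_of_me`), which the weights `1 / (N * 2 ^ (N + 1))` absorb.
-/

open MeasureTheory Filter Topology
open scoped ENNReal

noncomputable section

namespace MM

/-! ### Parameters and couplings -/

theorem leb_apply (s : Set I) : leb s = volume (Subtype.val '' s : Set ℝ) :=
  comap_subtype_coe_apply measurableSet_Ico _ _

instance : IsProbabilityMeasure leb :=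
  ⟨by rw [leb_apply, Set.image_univ, Subtype.range_coe]; simp⟩

theorem exists_parameter {E : Type*} [MeasurableSpace E] [StandardBorelSpace E] (μ : Measure E)
    [IsProbabilityMeasure μ] : ∃ φ : I → E, Measurable φ ∧ leb.map φ = μ := by
  have : Nonempty E := μ.nonempty_of_neZero
  obtain ⟨g, hg, hgm⟩ := μ.exists_measurable_map_eq
  have hsub : Set.Ico (0 : ℝ) 1 ⊆ unitInterval := Set.Ico_subset_Icc_self
  have hinc : Measurable (Set.inclusion hsub) := measurable_inclusion hsub
  refine ⟨g ∘ Set.inclusion hsub, hg.comp hinc, ?_⟩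
  rw [← Measure.map_map hg hinc, ← hgm]
  congr 1
  ext s hs
  have hvol : (volume : Measure unitInterval) s = volume (Subtype.val '' s : Set ℝ) :=
    comap_subtype_coe_apply measurableSet_Icc _ _
  rw [Measure.map_apply hinc hs, leb_apply, hvol]
  -- the two sets differ at most by the endpoint `1`
  refine le_antisymm (measure_mono ?_) ?_
  · rintro _ ⟨x, hx, rfl⟩
    exact ⟨_, hx, rfl⟩
  · have hcov : (Subtype.val '' s : Set ℝ) ⊆
        Subtype.val '' (Set.inclusion hsub ⁻¹' s) ∪ {1} := by
      rintro _ ⟨x, hx, rfl⟩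
      rcases eq_or_lt_of_le x.2.2 with h | h
      · exact Or.inr h
      · exact Or.inl ⟨⟨x, x.2.1, h⟩, hx, rfl⟩
    exact (measure_mono hcov).trans ((measure_union_le _ _).trans (by simp))

theorem inv_mul_smul_of_measure_univ_eq {Z : Type*} [MeasurableSpace Z] {τ : Measure Z} {c : ℝ≥0∞}
    (hc : c ≤ 1) (hτ : τ Set.univ = c) : (c⁻¹ * c) • τ = τ := by
  rcases eq_or_ne c 0 with rfl | h
  · rw [Measure.measure_univ_eq_zero.1 hτ, smul_zero]
  · rw [ENNReal.inv_mul_cancel h (ne_top_of_le_ne_top ENNReal.one_ne_top hc), one_smul]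

/-- A partial transport plan extends to a coupling: the missing mass is distributed as the
normalized product of the residual marginals. -/
theorem exists_coupling_ge {X Y : Type*} [MeasurableSpace X] [MeasurableSpace Y]
    (μ : Measure X) (ν : Measure Y) [IsProbabilityMeasure μ] [IsProbabilityMeasure ν]
    (σ : Measure (X × Y)) [IsFiniteMeasure σ] (h₁ : σ.fst ≤ μ) (h₂ : σ.snd ≤ ν) :
    ∃ π : Measure (X × Y), π.fst = μ ∧ π.snd = ν ∧ σ ≤ π := by
  have m₁ : (μ - σ.fst) Set.univ = 1 - σ Set.univ := by
    rw [Measure.sub_apply MeasurableSet.univ h₁, measure_univ, Measure.fst_univ]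
  have m₂ : (ν - σ.snd) Set.univ = 1 - σ Set.univ := by
    rw [Measure.sub_apply MeasurableSet.univ h₂, measure_univ, Measure.snd_univ]
  have : IsFiniteMeasure (μ - σ.fst) := ⟨by rw [m₁]; exact lt_of_le_of_lt tsub_le_self (by simp)⟩
  have : IsFiniteMeasure (ν - σ.snd) := ⟨by rw [m₂]; exact lt_of_le_of_lt tsub_le_self (by simp)⟩
  refine ⟨σ + (1 - σ Set.univ)⁻¹ • (μ - σ.fst).prod (ν - σ.snd), ?_, ?_,
    Measure.le_add_right le_rfl⟩
  · rw [Measure.fst, Measure.map_add _ _ measurable_fst, Measure.map_smul, ← Measure.fst,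
      Measure.map_fst_prod, m₂, smul_smul, inv_mul_smul_of_measure_univ_eq tsub_le_self m₁,
      add_comm, Measure.sub_add_cancel_of_le h₁]
  · rw [Measure.snd, Measure.map_add _ _ measurable_snd, Measure.map_smul, ← Measure.snd,
      Measure.map_snd_prod, m₁, smul_smul, inv_mul_smul_of_measure_univ_eq tsub_le_self m₂,
      add_comm, Measure.sub_add_cancel_of_le h₂]

theorem sum_smul_restrict_le {Z ι : Type*} [MeasurableSpace Z] (κ : Measure Z) (t : Finset ι)
    {D : ι → Set Z} (hD : ∀ i, MeasurableSet (D i)) (hDd : Pairwise (Function.onFun Disjoint D))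
    {d : ι → ℝ≥0∞} (hd : ∀ i, d i ≤ 1) : ∑ i ∈ t, d i • κ.restrict (D i) ≤ κ := by
  refine Measure.le_iff.2 fun s hs => ?_
  rw [Measure.finsetSum_apply]
  calc ∑ i ∈ t, (d i • κ.restrict (D i)) s ≤ ∑ i ∈ t, κ (s ∩ D i) := by
        refine Finset.sum_le_sum fun i _ => ?_
        rw [Measure.smul_apply, smul_eq_mul, Measure.restrict_apply hs]
        exact mul_le_of_le_one_left zero_le (hd i)
    _ = κ (⋃ i ∈ t, s ∩ D i) :=
        (measure_biUnion_finset (fun i _ j _ hij =>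
          (hDd hij).mono Set.inter_subset_right Set.inter_subset_right)
          fun i _ => hs.inter (hD i)).symm
    _ ≤ κ s := measure_mono (by simp)

/-- Two finite families of disjoint events, matched up block by block, have a coupling that puts
mass `min (μ Aᵢ) (ν Bᵢ)` on each block `Aᵢ × Bᵢ`. -/
theorem exists_coupling_blocks {X Y ι : Type*} [MeasurableSpace X] [MeasurableSpace Y]
    (μ : Measure X) (ν : Measure Y) [IsProbabilityMeasure μ] [IsProbabilityMeasure ν]
    (t : Finset ι) {A : ι → Set X} {B : ι → Set Y}
    (hA : ∀ i, MeasurableSet (A i)) (hB : ∀ i, MeasurableSet (B i))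
    (hAd : Pairwise (Function.onFun Disjoint A)) (hBd : Pairwise (Function.onFun Disjoint B)) :
    ∃ π : Measure (X × Y), π.fst = μ ∧ π.snd = ν ∧
      ∑ i ∈ t, min (μ (A i)) (ν (B i)) ≤ π (⋃ i ∈ t, A i ×ˢ B i) := by
  -- on a null block the density is `0 / 0 = 0`, as it should be
  set c : ι → ℝ≥0∞ := fun i => min (μ (A i)) (ν (B i)) / (μ (A i) * ν (B i)) with hc
  set τ : ι → Measure (X × Y) := fun i => (μ.restrict (A i)).prod (ν.restrict (B i)) with hτ
  have hcle : ∀ i, c i * (ν (B i)) ≤ 1 ∧ c i * (μ (A i)) ≤ 1 ∧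
      c i * (μ (A i) * ν (B i)) = min (μ (A i)) (ν (B i)) := by
    intro i
    rcases eq_or_ne (μ (A i)) 0 with h | h
    · simp [hc, h]
    rcases eq_or_ne (ν (B i)) 0 with h' | h'
    · simp [hc, h']
    have e : c i * (μ (A i) * ν (B i)) = min (μ (A i)) (ν (B i)) :=
      ENNReal.div_mul_cancel (mul_ne_zero h h')
        (ENNReal.mul_ne_top (measure_ne_top _ _) (measure_ne_top _ _))
    refine ⟨?_, ?_, e⟩
    · rw [← ENNReal.mul_le_mul_iff_left h (measure_ne_top _ _), one_mul, mul_assoc,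
        mul_comm (ν (B i)), e]
      exact min_le_left _ _
    · rw [← ENNReal.mul_le_mul_iff_left h' (measure_ne_top _ _), one_mul, mul_assoc, e]
      exact min_le_right _ _
  set σ : Measure (X × Y) := ∑ i ∈ t, c i • τ i with hσ
  have h₁ : σ.fst ≤ μ := by
    have : σ.fst = ∑ i ∈ t, (c i * ν (B i)) • μ.restrict (A i) := by
      ext s hs
      rw [Measure.fst_apply hs, hσ, Measure.finsetSum_apply, Measure.finsetSum_apply]
      refine Finset.sum_congr rfl fun i _ => ?_
      rw [Measure.smul_apply, Measure.smul_apply, ← Measure.fst_apply hs, Measure.fst,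
        Measure.map_fst_prod]
      simp [mul_assoc]
    rw [this]
    exact sum_smul_restrict_le μ t hA hAd fun i => (hcle i).1
  have h₂ : σ.snd ≤ ν := by
    have : σ.snd = ∑ i ∈ t, (c i * μ (A i)) • ν.restrict (B i) := by
      ext s hs
      rw [Measure.snd_apply hs, hσ, Measure.finsetSum_apply, Measure.finsetSum_apply]
      refine Finset.sum_congr rfl fun i _ => ?_
      rw [Measure.smul_apply, Measure.smul_apply, ← Measure.snd_apply hs, Measure.snd,
        Measure.map_snd_prod]
      simp [mul_assoc]
    rw [this]
    exact sum_smul_restrict_le ν t hB hBd fun i => (hcle i).2.1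
  have : IsFiniteMeasure σ := ⟨by
    rw [← Measure.fst_univ]
    exact (h₁ _).trans_lt (measure_lt_top _ _)⟩
  obtain ⟨π, hπ₁, hπ₂, hπ⟩ := exists_coupling_ge μ ν σ h₁ h₂
  refine ⟨π, hπ₁, hπ₂, le_trans ?_ (hπ _)⟩
  rw [hσ, Measure.finsetSum_apply]
  refine Finset.sum_le_sum fun i hi => ?_
  calc min (μ (A i)) (ν (B i)) = (c i • τ i) (A i ×ˢ B i) := by
        rw [Measure.smul_apply, smul_eq_mul, hτ, Measure.prod_prod, Measure.restrict_apply_self,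
          Measure.restrict_apply_self, (hcle i).2.2]
    _ ≤ _ := measure_mono (Set.subset_biUnion_of_mem (u := fun i => A i ×ˢ B i) hi)

/-- Matching blocks of almost full mass whose mutual distances nearly agree bound the box
distance. -/
theorem box_le_of_blocks {ι : Type*} (X Y : MMSpace) (t : Finset ι) {A : ι → Set X} {B : ι → Set Y}
    (hA : ∀ i, MeasurableSet (A i)) (hB : ∀ i, MeasurableSet (B i))
    (hAd : Pairwise (Function.onFun Disjoint A)) (hBd : Pairwise (Function.onFun Disjoint B))
    {ε : ℝ} (hmass : 1 - ENNReal.ofReal ε ≤ ∑ i ∈ t, min (X.meas (A i)) (Y.meas (B i)))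
    (hdist : ∀ i j, ∀ x ∈ A i, ∀ y ∈ B i, ∀ x' ∈ A j, ∀ y' ∈ B j,
      |dist x x' - dist y y'| ≤ ε) :
    box X Y ≤ ENNReal.ofReal ε := by
  obtain ⟨π, hπ₁, hπ₂, hπ⟩ := exists_coupling_blocks X.meas Y.meas t hA hB hAd hBd
  have : SecondCountableTopology X := UniformSpace.secondCountable_of_separable X
  have : SecondCountableTopology Y := UniformSpace.secondCountable_of_separable Y
  have : IsProbabilityMeasure π := ⟨by rw [← Measure.fst_univ, hπ₁, measure_univ]⟩
  obtain ⟨f, hf, hfm⟩ := exists_parameter π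
  have hU : MeasurableSet (⋃ i ∈ t, A i ×ˢ B i) :=
    Finset.measurableSet_biUnion _ fun i _ => (hA i).prod (hB i)
  refine sInf_le ⟨fun s => (f s).1, fun s => (f s).2, f ⁻¹' ⋃ i ∈ t, A i ×ˢ B i,
    ⟨measurable_fst.comp hf, ?_⟩, ⟨measurable_snd.comp hf, ?_⟩, hf hU, ?_, ?_⟩
  · rw [← hπ₁, Measure.fst, ← hfm, Measure.map_map measurable_fst hf]
    rfl
  · rw [← hπ₂, Measure.snd, ← hfm, Measure.map_map measurable_snd hf]
    rfl
  · intro s hs u hu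
    simp only [Set.mem_preimage, Set.mem_iUnion, Set.mem_prod] at hs hu
    obtain ⟨i, -, h1, h2⟩ := hs
    obtain ⟨j, -, h3, h4⟩ := hu
    exact ENNReal.ofReal_le_ofReal (hdist i j _ h1 _ h2 _ h3 _ h4)
  · rw [← Measure.map_apply hf hU, hfm]
    exact hmass.trans hπ

/-! ### The mm-space of a measure and the Lipschitz order -/

/-- As an mm-space has full support, a continuous map sends it into the support of its law. -/
theorem mem_support_map {E : Type*} [TopologicalSpace E] [MeasurableSpace E] [BorelSpace E]
    (X : MMSpace) {F : X → E} (hF : Continuous F) (x : X) :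
    F x ∈ (X.meas.map F).support := by
  rw [Measure.mem_support_iff_forall]
  intro U hU
  obtain ⟨V, hVU, hV, hxV⟩ := mem_nhds_iff.1 hU
  refine lt_of_lt_of_le ?_ (measure_mono hVU)
  rw [Measure.map_apply hF.measurable hV.measurableSet]
  have hx : x ∈ X.meas.support := X.support_eq ▸ Set.mem_univ x
  exact (Measure.mem_support_iff_forall x).1 hx _ ((hV.preimage hF).mem_nhds hxV)

section ofMeasure

variable {E : Type} [MetricSpace E] [MeasurableSpace E] [BorelSpace E] [CompleteSpace E]
  [SecondCountableTopology E]

/-- The inclusion into `E` of the mm-space `(E, d, μ)`, whose points are those of the support. -/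
def ofMeasureVal (μ : Measure E) [IsProbabilityMeasure μ] : ofMeasure μ → E :=
  fun x => Subtype.val (p := fun y => y ∈ μ.support) x

theorem isometry_ofMeasureVal (μ : Measure E) [IsProbabilityMeasure μ] :
    Isometry (ofMeasureVal μ) := fun _ _ => rfl

theorem measurable_ofMeasureVal (μ : Measure E) [IsProbabilityMeasure μ] :
    Measurable (ofMeasureVal μ) := (isometry_ofMeasureVal μ).continuous.measurable

theorem ofMeasureVal_mem_support (μ : Measure E) [IsProbabilityMeasure μ] (x : ofMeasure μ) :
    ofMeasureVal μ x ∈ μ.support :=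
  Subtype.property (p := fun y => y ∈ μ.support) x

theorem map_ofMeasureVal (μ : Measure E) [IsProbabilityMeasure μ] :
    (ofMeasure μ).meas.map (ofMeasureVal μ) = μ := by
  have h : (ofMeasure μ).meas.map (ofMeasureVal μ) =
      (μ.comap (Subtype.val : μ.support → E)).map Subtype.val := rfl
  rw [h, map_comap_subtype_coe Measure.isClosed_support.measurableSet,
    Measure.restrict_eq_self_of_ae_mem (s := μ.support) Measure.support_mem_ae]

theorem dominated_ofMeasure_iff (X : MMSpace) (ν : Measure E) [IsProbabilityMeasure ν] :
    Dominated (ofMeasure ν) X ↔ ∃ F : X → E, LipschitzWith 1 F ∧ X.meas.map F = ν := by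
  constructor
  · rintro ⟨f, hf, hfm⟩
    refine ⟨ofMeasureVal ν ∘ f, by simpa using (isometry_ofMeasureVal ν).lipschitz.comp hf, ?_⟩
    rw [← Measure.map_map (measurable_ofMeasureVal ν) hf.continuous.measurable, hfm,
      map_ofMeasureVal]
  · rintro ⟨F, hF, rfl⟩
    let f : X → (X.meas.map F).support := fun x => ⟨F x, mem_support_map X hF.continuous x⟩
    have hf : LipschitzWith 1 f := fun x y => hF x y
    refine ⟨f, hf, ?_⟩
    have hs : MeasurableSet (X.meas.map F).support := Measure.isClosed_support.measurableSet
    change X.meas.map f = (X.meas.map F).comap Subtype.val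
    ext s hm
    rw [Measure.map_apply hf.continuous.measurable hm, comap_support_apply,
      Measure.map_apply hF.continuous.measurable (hs.subtype_image hm)]
    congr 1
    ext x
    simp only [Set.mem_preimage]
    constructor
    · exact fun h => ⟨_, h, rfl⟩
    · rintro ⟨y, hy, h⟩
      have : f x = y := Subtype.ext h.symm
      rwa [this]

end ofMeasure

/-! ### Box-approximation by measures close to a law -/

theorem null_frontier_diff {E : Type*} [TopologicalSpace E] [MeasurableSpace E] {μ : Measure E}
    {s t : Set E} (hs : μ (frontier s) = 0) (ht : μ (frontier t) = 0) :
    μ (frontier (s \ t)) = 0 := by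
  have h : frontier (s \ t) ⊆ frontier s ∪ frontier t := by
    rw [Set.sdiff_eq, ← frontier_compl t]
    exact (frontier_inter_subset s tᶜ).trans
      (Set.union_subset_union Set.inter_subset_left Set.inter_subset_right)
  exact measure_mono_null h (measure_union_null hs ht)

theorem exists_partition_null_frontier {E : Type*} [PseudoMetricSpace E] [MeasurableSpace E]
    [BorelSpace E] [TopologicalSpace.SeparableSpace E] [Nonempty E] (μ : Measure E) [SFinite μ]
    {ε : ℝ} (hε : 0 < ε) :
    ∃ B : ℕ → Set E, (∀ i, MeasurableSet (B i)) ∧ Pairwise (Function.onFun Disjoint B) ∧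
      (⋃ i, B i = Set.univ) ∧ (∀ i, μ (frontier (B i)) = 0) ∧
      ∀ i, ∀ x ∈ B i, ∀ y ∈ B i, dist x y ≤ ε := by
  have hr : ∀ i, ∃ r ∈ Set.Ioo (ε / 4) (ε / 2),
      μ (frontier (Metric.thickening r {TopologicalSpace.denseSeq E i})) = 0 := fun i =>
    exists_null_frontier_thickening μ _ (by linarith)
  choose r hr hr0 using hr
  refine ⟨disjointed fun i => Metric.thickening (r i) {TopologicalSpace.denseSeq E i},
    MeasurableSet.disjointed fun i => Metric.isOpen_thickening.measurableSet,
    disjoint_disjointed _, ?_, fun i => ?_, fun i x hx y hy => ?_⟩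
  · rw [iUnion_disjointed, Set.eq_univ_iff_forall]
    intro x
    obtain ⟨i, hi⟩ := (TopologicalSpace.denseRange_denseSeq E).exists_dist_lt x
      (show 0 < ε / 4 by linarith)
    rw [Set.mem_iUnion]
    refine ⟨i, ?_⟩
    rw [Metric.thickening_singleton]
    exact hi.trans (hr i).1
  · exact disjointedRec (p := fun s => μ (frontier s) = 0)
      (fun t j ht => null_frontier_diff ht (hr0 j)) (hr0 i)
  · have hx' := disjointed_subset _ _ hx
    have hy' := disjointed_subset _ _ hy
    rw [Metric.thickening_singleton, Metric.mem_ball] at hx' hy'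
    have := dist_triangle_right x y (TopologicalSpace.denseSeq E i)
    have := (hr i).2
    linarith

/-- If a map `F` on `X` nearly preserves distances on a set of almost full measure, then `X` is
box-close to every measure that is weakly close to the law of `F`. -/
theorem eventually_box_ofMeasure_le {E : Type} [MetricSpace E] [MeasurableSpace E] [BorelSpace E]
    [CompleteSpace E] [SecondCountableTopology E] (X : MMSpace) {F : X → E} (hF : Measurable F)
    {S : Set X} (hS : MeasurableSet S) {ε : ℝ} (hε : 0 < ε)
    (hmass : 1 - ENNReal.ofReal ε ≤ X.meas S)
    (hd : ∀ x ∈ S, ∀ y ∈ S, |dist x y - dist (F x) (F y)| ≤ ε)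
    {ι : Type*} {L : Filter ι} {ν : ι → ProbabilityMeasure E} {μ : ProbabilityMeasure E}
    (hμ : X.meas.map F = μ) (hν : Tendsto ν L (𝓝 μ)) :
    ∀ᶠ n in L, box X (ofMeasure (ν n : Measure E)) ≤ ENNReal.ofReal (4 * ε) := by
  have hXne : Nonempty X := X.meas.nonempty_of_neZero
  have : Nonempty E := hXne.map F
  obtain ⟨B, hB, hBd, hBU, hB0, hBε⟩ := exists_partition_null_frontier (μ : Measure E) hε
  set A : ℕ → Set X := fun i => S ∩ F ⁻¹' B i
  have hA : ∀ i, MeasurableSet (A i) := fun i => hS.inter (hF (hB i))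
  have hAd : Pairwise (Function.onFun Disjoint A) := fun i j hij =>
    ((hBd hij).preimage F).mono Set.inter_subset_right Set.inter_subset_right
  have hsum : Tendsto (fun K => ∑ i ∈ Finset.range K, X.meas (A i)) atTop (𝓝 (X.meas S)) := by
    have hAU : ⋃ i, A i = S := by
      rw [← Set.inter_iUnion, ← Set.preimage_iUnion, hBU, Set.preimage_univ, Set.inter_univ]
    rw [← hAU, measure_iUnion hAd hA]
    exact ENNReal.tendsto_nat_tsum _
  have hev : ∀ᶠ n in L, ∃ K, 1 - ENNReal.ofReal (4 * ε) ≤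
      ∑ i ∈ Finset.range K, min (X.meas (A i)) ((ν n : Measure E) (B i)) := by
    rcases le_or_gt 1 (ENNReal.ofReal (4 * ε)) with h1 | h1
    · exact Eventually.of_forall fun n => ⟨0, (tsub_eq_zero_of_le h1).trans_le zero_le⟩
    have hlt : 1 - ENNReal.ofReal (4 * ε) < X.meas S := by
      -- the strict gap between `ε` and `4 * ε` leaves room to keep only finitely many pieces
      refine lt_of_lt_of_le ?_ hmass
      refine ENNReal.sub_lt_of_sub_lt h1.le (Or.inl ENNReal.one_ne_top) ?_
      rw [ENNReal.sub_sub_cancel ENNReal.one_ne_top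
        ((ENNReal.ofReal_le_ofReal (by linarith)).trans h1.le)]
      exact (ENNReal.ofReal_lt_ofReal_iff (by linarith)).2 (by linarith)
    obtain ⟨K, hK⟩ := (hsum.eventually (lt_mem_nhds hlt)).exists
    have hlim : Tendsto (fun n => ∑ i ∈ Finset.range K,
        min (X.meas (A i)) ((ν n : Measure E) (B i))) L
        (𝓝 (∑ i ∈ Finset.range K, min (X.meas (A i)) ((μ : Measure E) (B i)))) :=
      tendsto_finsetSum _ fun i _ => tendsto_const_nhds.min
        (ProbabilityMeasure.tendsto_measure_of_null_frontier_of_tendsto' hν (hB0 i))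
    have hmin : ∀ i, min (X.meas (A i)) ((μ : Measure E) (B i)) = X.meas (A i) := by
      intro i
      rw [← hμ, Measure.map_apply hF (hB i)]
      exact min_eq_left (measure_mono Set.inter_subset_right)
    simp only [hmin] at hlim
    filter_upwards [hlim.eventually (lt_mem_nhds hK)] with n hn
    exact ⟨K, hn.le⟩
  filter_upwards [hev] with n ⟨K, hK⟩
  have hval := measurable_ofMeasureVal (ν n : Measure E)
  refine box_le_of_blocks X _ (Finset.range K) hA
    (B := fun i => ofMeasureVal (ν n : Measure E) ⁻¹' B i) (fun i => hval (hB i)) hAd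
    (fun i j hij => (hBd hij).preimage _) ?_ ?_
  · simp only [← Measure.map_apply hval (hB _), map_ofMeasureVal]
    exact hK
  · intro i j x hx y hy x' hx' y' hy'
    have h1 := hd x hx.1 x' hx'.1
    have h2 := hBε i _ hx.2 _ hy
    have h3 := hBε j _ hx'.2 _ hy'
    have h4 : dist y y' = dist (ofMeasureVal (ν n : Measure E) y) (ofMeasureVal (ν n) y') :=
      ((isometry_ofMeasureVal _).dist_eq y y').symm
    have h5 := dist_dist_dist_le (F x) (F x') (ofMeasureVal (ν n : Measure E) y)
      (ofMeasureVal (ν n) y')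
    rw [Real.dist_eq] at h5
    rw [h4]
    rw [abs_le] at *
    constructor <;> linarith [h1.1, h1.2, h5.1, h5.2]

/-- Distance functions to finitely many points, truncated, nearly embed `X` isometrically into a
finite-dimensional sup-normed space, off a set of small measure. The truncation level `N * R` is
affordable since the points may be padded to make the dimension `N` large. -/
theorem exists_lipschitz_almost_isometry (X : MMSpace) {R ε : ℝ} (hR : 0 < R) (hε : 0 < ε) :
    ∃ (n : ℕ) (F : X → Fin (n + 1) → ℝ) (S : Set X), LipschitzWith 1 F ∧
      (∀ x, ‖F x‖ ≤ (n + 1 : ℕ) * R) ∧ MeasurableSet S ∧ 1 - ENNReal.ofReal ε ≤ X.meas S ∧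
      ∀ x ∈ S, ∀ y ∈ S, |dist x y - dist (F x) (F y)| ≤ ε := by
  have hXne : Nonempty X := X.meas.nonempty_of_neZero
  set p := TopologicalSpace.denseSeq X
  have hmono : Monotone fun K : ℕ => ⋃ i ∈ Finset.range K, Metric.ball (p i) (ε / 2) :=
    fun K K' h => Set.biUnion_subset_biUnion_left fun i hi =>
      Finset.mem_coe.2 (Finset.range_mono h hi)
  have hU : ⋃ K : ℕ, ⋃ i ∈ Finset.range K, Metric.ball (p i) (ε / 2) = Set.univ := by
    refine Set.eq_univ_iff_forall.2 fun x => ?_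
    obtain ⟨i, hi⟩ := (TopologicalSpace.denseRange_denseSeq X).exists_dist_lt x (half_pos hε)
    simp only [Set.mem_iUnion]
    exact ⟨i + 1, i, by simp, hi⟩
  have hlim := tendsto_measure_iUnion_atTop (μ := X.meas) hmono
  rw [hU, measure_univ] at hlim
  have hlt : 1 - ENNReal.ofReal ε < 1 :=
    ENNReal.sub_lt_self ENNReal.one_ne_top one_ne_zero (by simpa using hε)
  obtain ⟨K, hK⟩ := (hlim.eventually (lt_mem_nhds hlt)).exists
  set S := ⋃ i ∈ Finset.range K, Metric.ball (p i) (ε / 2)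
  have hSb : Bornology.IsBounded S :=
    (Bornology.isBounded_biUnion_finset _).2 fun i _ => Metric.isBounded_ball
  obtain ⟨D, hD⟩ := Metric.isBounded_iff.1 hSb
  obtain ⟨M, hM⟩ := exists_nat_ge (D / R)
  have hDM : D ≤ M * R := (div_le_iff₀ hR).1 hM
  set n := max K M
  set C : ℝ := (n + 1 : ℕ) * R
  have hC0 : 0 ≤ C := by positivity
  have hDC : D ≤ C := hDM.trans (mul_le_mul_of_nonneg_right
    (by exact_mod_cast (le_max_right K M).trans (Nat.le_succ _)) hR.le)
  set F : X → Fin (n + 1) → ℝ := fun x i => min (dist x (p i)) C with hFdef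
  have hF : LipschitzWith 1 F := LipschitzWith.of_dist_le_mul fun x y => by
    rw [NNReal.coe_one, one_mul, dist_pi_le_iff dist_nonneg]
    exact fun i => by simpa using ((LipschitzWith.dist_left (p i)).min_const C).dist_le_mul x y
  refine ⟨n, F, S, hF, fun x => ?_, ?_, hK.le, fun x hx y hy => ?_⟩
  · rw [pi_norm_le_iff_of_nonneg hC0]
    intro i
    rw [Real.norm_eq_abs, abs_of_nonneg (le_min dist_nonneg hC0)]
    exact min_le_right _ _
  · exact Finset.measurableSet_biUnion _ fun i _ => measurableSet_ball
  · have h1 : dist (F x) (F y) ≤ dist x y := by simpa using hF.dist_le_mul x y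
    obtain ⟨i, hi, hxi⟩ := Set.mem_iUnion₂.1 hx
    have hpS : p i ∈ S := Set.mem_iUnion₂.2 ⟨i, hi, Metric.mem_ball_self (half_pos hε)⟩
    have hin : i < n + 1 :=
      (Finset.mem_range.1 hi).trans_le ((le_max_left K M).trans (Nat.le_succ _))
    have h2 := dist_le_pi_dist (F x) (F y) ⟨i, hin⟩
    have h3 : F x ⟨i, hin⟩ = dist x (p i) := min_eq_left ((hD hx hpS).trans hDC)
    have h4 : F y ⟨i, hin⟩ = dist y (p i) := min_eq_left ((hD hy hpS).trans hDC)
    rw [h3, h4, Real.dist_eq] at h2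
    have h5 := neg_abs_le (dist x (p i) - dist y (p i))
    have h6 := dist_triangle_right x y (p i)
    rw [Metric.mem_ball] at hxi
    rw [abs_le]
    constructor <;> linarith

/-! ### Prokhorov distance of laws and transfer of Lipschitz functions -/

/-- The Ky Fan bound: random variables that are close in probability have close laws. -/
theorem levyProkhorovEDist_map_le {Ω E : Type*} [MeasurableSpace Ω] [PseudoEMetricSpace E]
    [MeasurableSpace E] [OpensMeasurableSpace E] (P : Measure Ω) [IsProbabilityMeasure P]
    {U V : Ω → E} (hU : Measurable U) (hV : Measurable V) {δ : ℝ≥0∞}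
    (h : P {s | δ < edist (U s) (V s)} ≤ δ) :
    levyProkhorovEDist (P.map U) (P.map V) ≤ δ := by
  have : IsProbabilityMeasure (P.map U) := Measure.isProbabilityMeasure_map hU.aemeasurable
  have : IsProbabilityMeasure (P.map V) := Measure.isProbabilityMeasure_map hV.aemeasurable
  refine levyProkhorovEDist_le_of_forall_le _ _ _ fun ε B hε hε' hB => ?_
  rw [Measure.map_apply hU hB, Measure.map_apply hV Metric.isOpen_thickening.measurableSet]
  have hsub : U ⁻¹' B ⊆ V ⁻¹' Metric.thickening ε.toReal B ∪ {s | δ < edist (U s) (V s)} := by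
    intro s hs
    rcases lt_or_ge δ (edist (U s) (V s)) with h' | h'
    · exact Or.inr h'
    · refine Or.inl ?_
      rw [Set.mem_preimage, Metric.mem_thickening_iff_exists_edist_lt]
      exact ⟨U s, hs, by rw [edist_comm, ENNReal.ofReal_toReal hε'.ne]; exact h'.trans_lt hε⟩
  exact (measure_mono hsub).trans ((measure_union_le _ _).trans
    (add_le_add_right (h.trans hε.le) _))

/-- Truncation of a real number to the interval `[-R, R]`. -/
def clamp (R t : ℝ) : ℝ := max (-R) (min R t)

theorem lipschitzWith_clamp (R : ℝ) : LipschitzWith 1 (clamp R) :=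
  (LipschitzWith.id.const_min R).const_max (-R)

theorem abs_clamp_le {R : ℝ} (hR : 0 ≤ R) (t : ℝ) : |clamp R t| ≤ R :=
  abs_le.2 ⟨le_max_left _ _, max_le (by linarith) (min_le_left _ _)⟩

theorem clamp_eq_self {R t : ℝ} (h : |t| ≤ R) : clamp R t = t := by
  rw [clamp, min_eq_right (abs_le.1 h).2, max_eq_right (abs_le.1 h).1]

theorem abs_sub_clamp_le {R t : ℝ} (h : |t| ≤ R) (u : ℝ) : |t - clamp R u| ≤ |t - u| := by
  have := (lipschitzWith_clamp R).dist_le_mul t u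
  rwa [NNReal.coe_one, one_mul, clamp_eq_self h, Real.dist_eq, Real.dist_eq] at this

/-- Transfer of a bounded `1`-Lipschitz function along a correspondence of distortion at most `ε`,
by McShane's formula. -/
theorem exists_lipschitz_transfer {X Y T : Type*} [PseudoMetricSpace X] [PseudoMetricSpace Y]
    {φ : T → X} {ψ : T → Y} {S : Set T} {ε : ℝ}
    (hd : ∀ s ∈ S, ∀ t ∈ S, |dist (φ s) (φ t) - dist (ψ s) (ψ t)| ≤ ε)
    {f : X → ℝ} (hf : LipschitzWith 1 f) {R : ℝ} (hR : 0 ≤ R) (hfR : ∀ x, |f x| ≤ R) :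
    ∃ g : Y → ℝ, LipschitzWith 1 g ∧ (∀ y, |g y| ≤ R) ∧ ∀ s ∈ S, |f (φ s) - g (ψ s)| ≤ ε := by
  rcases S.eq_empty_or_nonempty with rfl | hS
  · exact ⟨fun _ => 0, LipschitzWith.const' 0, fun _ => by simpa using hR, fun _ h => h.elim⟩
  have : Nonempty S := hS.to_subtype
  set g : Y → ℝ := fun y => ⨅ s : S, (f (φ s) + dist (ψ s) y)
  have hbdd : ∀ y, BddBelow (Set.range fun s : S => f (φ s) + dist (ψ s) y) := fun y =>
    ⟨-R, by
      rintro _ ⟨s, rfl⟩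
      have := (abs_le.1 (hfR (φ s))).1
      have := dist_nonneg (x := ψ s) (y := y)
      simp only
      linarith⟩
  have hgL : LipschitzWith 1 g := LipschitzWith.of_le_add fun y z => by
    rw [← sub_le_iff_le_add]
    refine le_ciInf fun s => ?_
    have h1 : g y ≤ f (φ s) + dist (ψ s) y := ciInf_le (hbdd y) s
    have h2 := dist_triangle_right (ψ s) y z
    linarith
  refine ⟨fun y => clamp R (g y),
    by simpa [Function.comp_def] using (lipschitzWith_clamp R).comp hgL,
    fun y => abs_clamp_le hR _, fun s hs => (abs_sub_clamp_le (hfR _) _).trans ?_⟩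
  have h1 : g (ψ s) ≤ f (φ s) := by
    simpa using ciInf_le (hbdd (ψ s)) (⟨s, hs⟩ : S)
  have h2 : f (φ s) - ε ≤ g (ψ s) := by
    refine le_ciInf fun t => ?_
    have h3 := (abs_le.1 (hd t t.2 s hs)).2
    have h4 := (abs_le.1 ((Real.dist_eq _ _).symm.trans_le (hf.dist_le_mul (φ s) (φ t)))).2
    rw [dist_comm (φ s)] at h4
    simp only [NNReal.coe_one, one_mul] at h4
    linarith
  rw [abs_le]
  constructor <;> linarith [(abs_nonneg _).trans (hd s hs s hs)]

theorem lipschitzWith_one_pi {X ι : Type*} [Fintype ι] [PseudoMetricSpace X] {F : X → ι → ℝ} :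
    LipschitzWith 1 F ↔ ∀ i, LipschitzWith 1 fun x => F x i :=
  ⟨fun h i => by simpa [Function.comp_def] using (LipschitzWith.eval i).comp h, fun h x y => by
    rw [ENNReal.coe_one, one_mul]
    exact edist_pi_le_iff.2 fun i => by simpa using h i x y⟩

/-- The law of a measurable map from an mm-space to `ℝ^N`. -/
def law {N : ℕ} (X : MMSpace) (F : X → Fin N → ℝ) (hF : Measurable F) : ProbOn N :=
  ⟨⟨X.meas.map F, Measure.isProbabilityMeasure_map hF.aemeasurable⟩⟩

theorem edist_law_le_of_parameters {N : ℕ} {X Y : MMSpace} {φ : I → X} {ψ : I → Y}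
    (hφ : IsParameter X φ) (hψ : IsParameter Y ψ) {F : X → Fin N → ℝ} {G : Y → Fin N → ℝ}
    (hF : Measurable F) (hG : Measurable G) {δ : ℝ≥0∞}
    (h : leb {s | δ < edist (F (φ s)) (G (ψ s))} ≤ δ) : edist (law X F hF) (law Y G hG) ≤ δ := by
  rw [LevyProkhorov.edist_probabilityMeasure_def]
  change levyProkhorovEDist (X.meas.map F) (Y.meas.map G) ≤ δ
  rw [← hφ.2, ← hψ.2, Measure.map_map hF hφ.1, Measure.map_map hG hψ.1]
  exact levyProkhorovEDist_map_le leb (hF.comp hφ.1) (hG.comp hψ.1) h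

/-- If `Y` is box-close to `X`, then laws of bounded `1`-Lipschitz maps on `X` are
Prokhorov-close to laws of such maps on `Y`. -/
theorem exists_law_near_of_box_lt {N : ℕ} {X Y : MMSpace} {δ : ℝ≥0∞} (h : box X Y < δ)
    {F : X → Fin N → ℝ} (hF : LipschitzWith 1 F) {R : ℝ} (hR : 0 ≤ R) (hFR : ∀ x, ‖F x‖ ≤ R) :
    ∃ (G : Y → Fin N → ℝ) (hG : LipschitzWith 1 G), (∀ y, ‖G y‖ ≤ R) ∧
      edist (law X F hF.continuous.measurable) (law Y G hG.continuous.measurable) ≤ δ := by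
  obtain ⟨ε, ⟨φ, ψ, S, hφ, hψ, hS, hd, hm⟩, hε⟩ := sInf_lt_iff.1 h
  have hεtop : ε ≠ ⊤ := (hε.trans_le le_top).ne
  have hd' : ∀ s ∈ S, ∀ t ∈ S, |dist (φ s) (φ t) - dist (ψ s) (ψ t)| ≤ ε.toReal :=
    fun s hs t ht => (ENNReal.ofReal_le_iff_le_toReal hεtop).1 (hd s hs t ht)
  choose g hg hgR hgε using fun i => exists_lipschitz_transfer hd' (lipschitzWith_one_pi.1 hF i) hR
    fun x => (norm_le_pi_norm (F x) i).trans (hFR x)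
  refine ⟨fun y i => g i y, lipschitzWith_one_pi.2 hg,
    fun y => (pi_norm_le_iff_of_nonneg hR).2 fun i => hgR i y, ?_⟩
  refine (edist_law_le_of_parameters hφ hψ _ _ ?_).trans hε.le
  have hsub : {s | ε < edist (F (φ s)) fun i => g i (ψ s)} ⊆ Sᶜ := by
    intro s hs hsS
    refine absurd hs (not_lt.2 (edist_pi_le_iff.2 fun i => ?_))
    rw [edist_dist, Real.dist_eq]
    exact (ENNReal.ofReal_le_iff_le_toReal hεtop).2 (hgε i s hsS)
  refine (measure_mono hsub).trans ?_
  rw [prob_compl_eq_one_sub hS]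
  exact tsub_le_iff_tsub_le.1 hm

theorem leb_lt_le_of_me_lt {f g : I → ℝ} {c : ℝ≥0∞} (h : me f g < c) :
    leb {s | c < ENNReal.ofReal |f s - g s|} ≤ c := by
  obtain ⟨ε, hε, hεc⟩ := sInf_lt_iff.1 h
  exact (measure_mono fun s hs => hεc.trans hs).trans (le_trans hε hεc.le)

/-- If every `1`-Lipschitz function on `X` is `me`-close to one on `Y`, then laws of bounded
`1`-Lipschitz maps on `X` are Prokhorov-close to laws of such maps on `Y`, with a loss of the
factor `N` from the union bound over the coordinates. -/
theorem exists_law_near_of_me {N : ℕ} (hN : N ≠ 0) {X Y : MMSpace} {φ : I → X} {ψ : I → Y}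
    (hφ : IsParameter X φ) (hψ : IsParameter Y ψ) {c : ℝ≥0∞}
    (h : ∀ f : X → ℝ, LipschitzWith 1 f → ∃ g : Y → ℝ, LipschitzWith 1 g ∧
      leb {s | c < ENNReal.ofReal |f (φ s) - g (ψ s)|} ≤ c)
    {F : X → Fin N → ℝ} (hF : LipschitzWith 1 F) {R : ℝ} (hR : 0 ≤ R) (hFR : ∀ x, ‖F x‖ ≤ R) :
    ∃ (G : Y → Fin N → ℝ) (hG : LipschitzWith 1 G), (∀ y, ‖G y‖ ≤ R) ∧
      edist (law X F hF.continuous.measurable) (law Y G hG.continuous.measurable) ≤ N * c := by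
  choose g hg hgc using fun i => h _ (lipschitzWith_one_pi.1 hF i)
  refine ⟨fun y i => clamp R (g i y), lipschitzWith_one_pi.2 fun i => by
      simpa [Function.comp_def] using (lipschitzWith_clamp R).comp (hg i),
    fun y => (pi_norm_le_iff_of_nonneg hR).2 fun i => abs_clamp_le hR _, ?_⟩
  refine edist_law_le_of_parameters hφ hψ _ _ ?_
  have hsub : {s | (N : ℝ≥0∞) * c < edist (F (φ s)) fun i => clamp R (g i (ψ s))} ⊆
      ⋃ i : Fin N, {s | c < ENNReal.ofReal |F (φ s) i - g i (ψ s)|} := by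
    intro s hs
    by_contra hcon
    simp only [Set.mem_iUnion, Set.mem_ofPred_eq, not_exists, not_lt] at hcon
    refine absurd hs (not_lt.2 (edist_pi_le_iff.2 fun i => ?_))
    rw [edist_dist, Real.dist_eq]
    calc _ ≤ ENNReal.ofReal |F (φ s) i - g i (ψ s)| := ENNReal.ofReal_le_ofReal
          (abs_sub_clamp_le ((norm_le_pi_norm (F (φ s)) i).trans (hFR _)) _)
      _ ≤ c := hcon i
      _ ≤ N * c := le_mul_of_one_le_left zero_le (by exact_mod_cast Nat.one_le_iff_ne_zero.2 hN)
  calc _ ≤ ∑ i : Fin N, leb {s | c < ENNReal.ofReal |F (φ s) i - g i (ψ s)|} :=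
        (measure_mono hsub).trans (measure_iUnion_fintype_le _ _)
    _ ≤ ∑ _i : Fin N, c := Finset.sum_le_sum fun i _ => hgc i
    _ = N * c := by simp

/-! ### Measurements -/

theorem prec_cls_iff {X Y : MMSpace} : X.cls.Prec Y.cls ↔ Dominated X Y := Iff.rfl

theorem exists_cls_eq (x : MMClass) : ∃ X : MMSpace, X.cls = x := Quotient.exists_rep x

theorem boxTo_le {X Y : MMSpace} {P : Set MMClass} (hY : Y.cls ∈ P) : boxTo X.cls P ≤ box X Y :=
  iInf₂_le Y.cls hY

theorem exists_box_lt {X : MMSpace} {P : Set MMClass} {δ : ℝ≥0∞} (h : boxTo X.cls P < δ) :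
    ∃ Y : MMSpace, Y.cls ∈ P ∧ box X Y < δ := by
  obtain ⟨y, hy⟩ := iInf_lt_iff.1 h
  obtain ⟨hyP, hlt⟩ := iInf_lt_iff.1 hy
  obtain ⟨Y, rfl⟩ := exists_cls_eq y
  exact ⟨Y, hyP, hlt⟩

/-- A set of mm-isomorphism classes is a lower set for the Lipschitz order. -/
def PrecLower (P : Set MMClass) : Prop := ∀ x ∈ P, ∀ y : MMClass, y.Prec x → y ∈ P

theorem precLower_assoc (X : MMSpace) : PrecLower (assoc X) := by
  intro x hx y hy
  obtain ⟨Y, rfl⟩ := exists_cls_eq y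
  obtain ⟨Z, rfl⟩ := exists_cls_eq x
  exact (prec_cls_iff.1 hy).trans hx

theorem law_mem_measurementBall {P : Set MMClass} (hP : PrecLower P) {X : MMSpace} (hX : X.cls ∈ P)
    {N : ℕ} {F : X → Fin N → ℝ} (hF : LipschitzWith 1 F) {R : ℝ} (hFR : ∀ x, ‖F x‖ ≤ R) :
    law X F hF.continuous.measurable ∈ measurementBall P N R := by
  have hm := hF.continuous.measurable
  refine ⟨hP _ hX _ (prec_cls_iff.2 ((dominated_ofMeasure_iff X _).2 ⟨F, hF, rfl⟩)), ?_⟩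
  have hcl : IsClosed {x : Fin N → ℝ | ‖x‖ ≤ R} := isClosed_le continuous_norm continuous_const
  refine Measure.support_subset_of_isClosed hcl ?_
  change ∀ᵐ x ∂(X.meas.map F), ‖x‖ ≤ R
  rw [ae_map_iff hm.aemeasurable hcl.measurableSet]
  exact ae_of_all _ hFR

theorem exists_law_of_mem_measurementBall {P : Set MMClass} {N : ℕ} {R : ℝ} {ν : ProbOn N}
    (hν : ν ∈ measurementBall P N R) :
    ∃ X : MMSpace, X.cls ∈ P ∧ ∃ (F : X → Fin N → ℝ) (hF : LipschitzWith 1 F),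
      (∀ x, ‖F x‖ ≤ R) ∧ law X F hF.continuous.measurable = ν :=
  ⟨ofMeasure (ν.toMeasure : Measure (Fin N → ℝ)), hν.1, ofMeasureVal _,
    (isometry_ofMeasureVal _).lipschitz, fun x => hν.2 (ofMeasureVal_mem_support _ x),
    LevyProkhorov.toMeasure_injective (Subtype.ext (map_ofMeasureVal _))⟩

theorem exists_law_of_mem_measurementBall_assoc {X : MMSpace} {N : ℕ} {R : ℝ} {ν : ProbOn N}
    (hν : ν ∈ measurementBall (assoc X) N R) :
    ∃ (F : X → Fin N → ℝ) (hF : LipschitzWith 1 F),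
      (∀ x, ‖F x‖ ≤ R) ∧ law X F hF.continuous.measurable = ν := by
  obtain ⟨F, hF, hFν⟩ := (dominated_ofMeasure_iff X (ν.toMeasure : Measure (Fin N → ℝ))).1 hν.1
  exact ⟨F, hF, fun x => hν.2 (hFν ▸ mem_support_map X hF.continuous x),
    LevyProkhorov.toMeasure_injective (Subtype.ext hFν)⟩

theorem measurementBall_nonempty {P : Set MMClass} (hP : PrecLower P) (hne : P.Nonempty) (N : ℕ)
    {R : ℝ} (hR : 0 ≤ R) : (measurementBall P N R).Nonempty := by
  obtain ⟨x, hx⟩ := hne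
  obtain ⟨X, rfl⟩ := exists_cls_eq x
  exact ⟨_, law_mem_measurementBall hP hx (F := fun _ => 0) (LipschitzWith.const' 0)
    fun _ => by simpa using hR⟩

/-- Prokhorov's theorem, for the constant family of compact sets `closedBall 0 R`. -/
theorem isCompact_ballMeasures (N : ℕ) (R : ℝ) : IsCompact (ballMeasures N R) := by
  have hK := isCompact_setOfPred_probabilityMeasure_mass_eq_compl_isCompact_le
    (E := Fin N → ℝ) (u := fun _ => 0) (K := fun _ => Metric.closedBall 0 R) tendsto_const_nhds
    (fun _ => isCompact_closedBall _ _) (Or.inr monotone_const)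
  have h := hK.image LevyProkhorov.probabilityMeasureHomeomorph.continuous
  convert h using 1
  ext μ
  have hcl : {x : Fin N → ℝ | ‖x‖ ≤ R} = Metric.closedBall 0 R := by ext; simp
  constructor
  · intro hμ
    refine ⟨μ.toMeasure, fun _ => ?_, rfl⟩
    rw [ballMeasures, Set.mem_ofPred_eq, hcl] at hμ
    have h0 : (μ.toMeasure : Measure (Fin N → ℝ)) (Metric.closedBall 0 R)ᶜ = 0 :=
      measure_mono_null (Set.compl_subset_compl.2 hμ) Measure.measure_compl_support
    exact (ProbabilityMeasure.null_iff_toMeasure_null _ _).2 h0 |>.le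
  · rintro ⟨ν, hν, rfl⟩
    refine Measure.support_subset_of_isClosed (hcl ▸ Metric.isClosed_closedBall) ?_
    rw [hcl, mem_ae_iff]
    exact (ProbabilityMeasure.null_iff_toMeasure_null _ _).1 (le_antisymm (hν 0) zero_le)

theorem isBounded_measurementBall (P : Set MMClass) (N : ℕ) (R : ℝ) :
    Bornology.IsBounded (measurementBall P N R) :=
  (isCompact_ballMeasures N R).isBounded.subset Set.inter_subset_right

theorem tendsto_toMeasure {N : ℕ} {ι : Type*} {L : Filter ι} {ν : ι → ProbOn N} {μ : ProbOn N}
    (h : Tendsto ν L (𝓝 μ)) : Tendsto (fun n => (ν n).toMeasure) L (𝓝 μ.toMeasure) :=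
  (LevyProkhorov.continuous_toMeasure_probabilityMeasure.tendsto μ).comp h

/-- Measures that are Prokhorov-close have box-close mm-spaces. -/
theorem tendsto_box_ofMeasure {N : ℕ} {ι : Type*} {L : Filter ι} {ν : ι → ProbOn N} {μ : ProbOn N}
    (h : Tendsto ν L (𝓝 μ)) {ε : ℝ} (hε : 0 < ε) :
    ∀ᶠ n in L, box (ofMeasure (μ.toMeasure : Measure (Fin N → ℝ)))
      (ofMeasure ((ν n).toMeasure : Measure (Fin N → ℝ))) ≤ ENNReal.ofReal (4 * ε) :=
  eventually_box_ofMeasure_le _ (measurable_ofMeasureVal _) MeasurableSet.univ hε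
    (by rw [measure_univ]; exact tsub_le_self)
    (fun x _ y _ => by rw [(isometry_ofMeasureVal _).dist_eq, sub_self, abs_zero]; exact hε.le)
    (map_ofMeasureVal _) (tendsto_toMeasure h)

theorem eq_zero_of_forall_le_ofReal {a : ℝ≥0∞}
    (h : ∀ ε : ℝ, 0 < ε → a ≤ ENNReal.ofReal (4 * ε)) : a = 0 := by
  refine le_antisymm (ENNReal.le_of_forall_pos_le_add fun ε hε _ => ?_) zero_le
  rw [zero_add]
  refine (h (ε / 4) (by positivity)).trans_eq ?_
  rw [mul_div_cancel₀ _ (by norm_num), ENNReal.ofReal_coe_nnreal]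

theorem isClosed_measurement {P : Set MMClass} (hP : IsPyramid P) (N : ℕ) :
    IsClosed (measurement P N) := by
  refine IsSeqClosed.isClosed fun ν μ hν hμ => hP.closed _
    (eq_zero_of_forall_le_ofReal fun ε hε => ?_)
  obtain ⟨n, hn⟩ := (tendsto_box_ofMeasure hμ hε).exists
  exact (boxTo_le (hν n)).trans hn

theorem isClosed_measurementBall {P : Set MMClass} (hP : IsPyramid P) (N : ℕ) (R : ℝ) :
    IsClosed (measurementBall P N R) :=
  (isClosed_measurement hP N).inter (isCompact_ballMeasures N R).isClosed

/-- An mm-space belongs to a pyramid as soon as the laws of its bounded `1`-Lipschitz maps are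
measurements of the pyramid. -/
theorem cls_mem_of_law_mem {P : Set MMClass} (hP : IsPyramid P) (X : MMSpace) {R : ℝ} (hR : 0 < R)
    (h : ∀ (n : ℕ) (F : X → Fin (n + 1) → ℝ) (hF : LipschitzWith 1 F),
      (∀ x, ‖F x‖ ≤ (n + 1 : ℕ) * R) →
        law X F hF.continuous.measurable ∈ measurementBall P (n + 1) ((n + 1 : ℕ) * R)) :
    X.cls ∈ P := by
  refine hP.closed _ (eq_zero_of_forall_le_ofReal fun ε hε => ?_)
  obtain ⟨n, F, S, hF, hFR, hS, hm, hd⟩ := exists_lipschitz_almost_isometry X hR hε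
  have hev := eventually_box_ofMeasure_le X hF.continuous.measurable hS hε hm hd (L := atTop)
    (ν := fun _ : ℕ => (law X F hF.continuous.measurable).toMeasure) rfl tendsto_const_nhds
  obtain ⟨_, hk⟩ := hev.exists
  exact (boxTo_le (h n F hF hFR).1).trans hk

/-! ### Distances between measurements -/

theorem measurementDist_nonneg (P P' : Set MMClass) (N : ℕ) (R : ℝ) :
    0 ≤ measurementDist P P' N R := Metric.hausdorffDist_nonneg

theorem dist_probOn_le_one {N : ℕ} (μ ν : ProbOn N) : dist μ ν ≤ 1 := by
  rw [LevyProkhorov.dist_probabilityMeasure_def]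
  refine ENNReal.toReal_le_of_le_ofReal zero_le_one
    ((levyProkhorovEDist_le_max_measure_univ _ _).trans ?_)
  simp

theorem measurementDist_le_one {P P' : Set MMClass} (hP : IsPyramid P) (hP' : IsPyramid P')
    (N : ℕ) {R : ℝ} (hR : 0 ≤ R) : measurementDist P P' N R ≤ 1 := by
  obtain ⟨μ, hμ⟩ := measurementBall_nonempty hP.lower hP.nonempty N hR
  obtain ⟨μ', hμ'⟩ := measurementBall_nonempty hP'.lower hP'.nonempty N hR
  exact Metric.hausdorffDist_le_of_mem_dist zero_le_one
    (fun x _ => ⟨μ', hμ', dist_probOn_le_one _ _⟩) (fun x _ => ⟨μ, hμ, dist_probOn_le_one _ _⟩)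

theorem hausdorffEDist_measurementBall_ne_top {P P' : Set MMClass} (hP : IsPyramid P)
    (hP' : IsPyramid P') (N : ℕ) {R : ℝ} (hR : 0 ≤ R) :
    Metric.hausdorffEDist (measurementBall P N R) (measurementBall P' N R) ≠ ⊤ :=
  Metric.hausdorffEDist_ne_top_of_nonempty_of_bounded
    (measurementBall_nonempty hP.lower hP.nonempty N hR)
    (measurementBall_nonempty hP'.lower hP'.nonempty N hR)
    (isBounded_measurementBall P N R) (isBounded_measurementBall P' N R)

/-- On `ℝ^0` there is only one probability measure. -/
theorem measurementDist_zero (P P' : Set MMClass) (R : ℝ) : measurementDist P P' 0 R = 0 := by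
  have hsub : ∀ μ ν : ProbOn 0, μ = ν := fun μ ν =>
    LevyProkhorov.toMeasure_injective (Subtype.ext (Measure.ext fun s _ => by
      rcases Subsingleton.set_cases (p := fun t => t = ∅ ∨ t = Set.univ)
        (Or.inl rfl) (Or.inr rfl) s with rfl | rfl <;> simp))
  rcases (measurementBall P 0 R).eq_empty_or_nonempty with h | ⟨μ, hμ⟩
  · rw [measurementDist, h, Metric.hausdorffDist_empty']
  rcases (measurementBall P' 0 R).eq_empty_or_nonempty with h | ⟨ν, hν⟩
  · rw [measurementDist, h, Metric.hausdorffDist_empty]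
  refine le_antisymm (Metric.hausdorffDist_le_of_mem_dist le_rfl
    (fun x _ => ⟨ν, hν, ?_⟩) (fun x _ => ⟨μ, hμ, ?_⟩)) (measurementDist_nonneg _ _ _ _)
  · rw [hsub x ν, dist_self]
  · rw [hsub x μ, dist_self]

/-- One half of the comparison of measurements with the observable distance. -/
theorem exists_near_measurement_of_me {N : ℕ} (hN : N ≠ 0) {X Y : MMSpace} {φ : I → X} {ψ : I → Y}
    (hφ : IsParameter X φ) (hψ : IsParameter Y ψ) {c : ℝ≥0∞}
    (h : ∀ f : X → ℝ, LipschitzWith 1 f → ∃ g : Y → ℝ, LipschitzWith 1 g ∧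
      leb {s | c < ENNReal.ofReal |f (φ s) - g (ψ s)|} ≤ c) {R : ℝ} (hR : 0 ≤ R)
    {μ : ProbOn N} (hμ : μ ∈ measurementBall (assoc X) N R) :
    ∃ ν ∈ measurementBall (assoc Y) N R, edist μ ν ≤ N * c := by
  obtain ⟨F, hF, hFR, rfl⟩ := exists_law_of_mem_measurementBall_assoc hμ
  obtain ⟨G, hG, hGR, hd⟩ := exists_law_near_of_me hN hφ hψ h hF hR hFR
  exact ⟨_, law_mem_measurementBall (precLower_assoc Y)
    (prec_cls_iff.2 (MMIso.refl Y).dominated) hG hGR, hd⟩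

theorem me_comm (f g : I → ℝ) : me f g = me g f := by
  simp only [me, abs_sub_comm]

theorem measurementDist_assoc_le {N : ℕ} (hN : N ≠ 0) {X Y : MMSpace} {c : ℝ≥0∞} (hc : c ≠ ⊤)
    (h : dconc X Y < c) {R : ℝ} (hR : 0 ≤ R) :
    measurementDist (assoc X) (assoc Y) N R ≤ N * c.toReal := by
  simp only [dconc, iInf_lt_iff] at h
  obtain ⟨φ, hφ, ψ, hψ, h⟩ := h
  have h₁ : ∀ f : X → ℝ, LipschitzWith 1 f → ∃ g : Y → ℝ, LipschitzWith 1 g ∧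
      leb {s | c < ENNReal.ofReal |f (φ s) - g (ψ s)|} ≤ c := by
    intro f hf
    have h' : ⨅ b ∈ pullbackLip ψ, me (f ∘ φ) b < c :=
      lt_of_le_of_lt (le_iSup₂_of_le (f ∘ φ) ⟨f, hf, rfl⟩ le_rfl)
        ((le_max_left _ _).trans_lt h)
    simp only [iInf_lt_iff] at h'
    obtain ⟨_, ⟨g, hg, rfl⟩, hlt⟩ := h'
    exact ⟨g, hg, leb_lt_le_of_me_lt hlt⟩
  have h₂ : ∀ g : Y → ℝ, LipschitzWith 1 g → ∃ f : X → ℝ, LipschitzWith 1 f ∧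
      leb {s | c < ENNReal.ofReal |g (ψ s) - f (φ s)|} ≤ c := by
    intro g hg
    have h' : ⨅ a ∈ pullbackLip φ, me a (g ∘ ψ) < c :=
      lt_of_le_of_lt (le_iSup₂_of_le (g ∘ ψ) ⟨g, hg, rfl⟩ le_rfl)
        ((le_max_right _ _).trans_lt h)
    simp only [iInf_lt_iff] at h'
    obtain ⟨_, ⟨f, hf, rfl⟩, hlt⟩ := h'
    exact ⟨f, hf, leb_lt_le_of_me_lt (me_comm _ _ ▸ hlt)⟩
  have hE : Metric.hausdorffEDist (measurementBall (assoc X) N R) (measurementBall (assoc Y) N R)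
      ≤ N * c := Metric.hausdorffEDist_le_of_mem_edist
    (fun _ hμ => exists_near_measurement_of_me hN hφ hψ h₁ hR hμ)
    (fun _ hν => exists_near_measurement_of_me hN hψ hφ h₂ hR hν)
  rw [measurementDist, Metric.hausdorffDist, ← ENNReal.toReal_natCast, ← ENNReal.toReal_mul]
  exact ENNReal.toReal_mono (ENNReal.mul_ne_top (ENNReal.natCast_ne_top N) hc) hE

/-! ### The series `ρ_R` -/

theorem rhoTerm_nonneg (R : ℝ) (P P' : Set MMClass) (N : ℕ) : 0 ≤ rhoTerm R P P' N :=
  mul_nonneg (by positivity) (measurementDist_nonneg _ _ _ _)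

theorem rhoTerm_le_of_le {R c : ℝ} {P P' : Set MMClass} {n : ℕ}
    (h : measurementDist P P' (n + 1) ((n + 1 : ℕ) * R) ≤ (n + 1 : ℕ) * c) :
    rhoTerm R P P' (n + 1) ≤ c / 2 / 2 / 2 ^ n := by
  have hpos : (0 : ℝ) < (n + 1 : ℕ) := by positivity
  calc rhoTerm R P P' (n + 1)
      ≤ 1 / (((n + 1 : ℕ) : ℝ) * 2 ^ (n + 1 + 1)) * ((n + 1 : ℕ) * c) :=
        mul_le_mul_of_nonneg_left h (by positivity)
    _ = c / 2 / 2 / 2 ^ n := by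
        field_simp
        ring

theorem rhoTerm_le {R : ℝ} (hR : 0 ≤ R) {P P' : Set MMClass} (hP : IsPyramid P)
    (hP' : IsPyramid P') (n : ℕ) : rhoTerm R P P' (n + 1) ≤ 1 / 2 / 2 / 2 ^ n :=
  rhoTerm_le_of_le ((measurementDist_le_one hP hP' _ (by positivity)).trans (by
    rw [mul_one]
    exact_mod_cast Nat.succ_le_succ (Nat.zero_le n)))

theorem summable_rhoTerm {R : ℝ} (hR : 0 ≤ R) {P P' : Set MMClass} (hP : IsPyramid P)
    (hP' : IsPyramid P') : Summable fun n : ℕ => rhoTerm R P P' (n + 1) :=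
  Summable.of_nonneg_of_le (fun _ => rhoTerm_nonneg _ _ _ _) (rhoTerm_le hR hP hP')
    (summable_geometric_two' (1 / 2))

theorem measurementDist_le_rho {R : ℝ} (hR : 0 ≤ R) {P P' : Set MMClass} (hP : IsPyramid P)
    (hP' : IsPyramid P') (N : ℕ) :
    measurementDist P P' N (N * R) ≤ N * 2 ^ (N + 1) * rho R P P' := by
  rcases N with _ | n
  · rw [measurementDist_zero]
    simp
  have h := (summable_rhoTerm hR hP hP').le_tsum n fun _ _ => rhoTerm_nonneg _ _ _ _
  have hpos : (0 : ℝ) < (n + 1 : ℕ) * 2 ^ (n + 1 + 1) := by positivity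
  rw [rhoTerm, one_div, inv_mul_le_iff₀ hpos] at h
  exact h

theorem rho_assoc_le_dconc (X Y : MMSpace) {R : ℝ} (hR : 0 ≤ R) :
    ENNReal.ofReal (rho R (assoc X) (assoc Y)) ≤ dconc X Y := by
  refine le_of_forall_gt_imp_ge_of_dense fun c hc => ?_
  rcases eq_or_ne c ⊤ with rfl | hct
  · exact le_top
  rw [ENNReal.ofReal_le_iff_le_toReal hct]
  have hle : ∀ n : ℕ, rhoTerm R (assoc X) (assoc Y) (n + 1) ≤ c.toReal / 2 / 2 / 2 ^ n := fun n =>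
    rhoTerm_le_of_le (measurementDist_assoc_le n.succ_ne_zero hct hc (by positivity))
  have hs := summable_geometric_two' (c.toReal / 2)
  refine ((Summable.of_nonneg_of_le (fun _ => rhoTerm_nonneg _ _ _ _) hle hs).tsum_le_tsum
    hle hs).trans ?_
  rw [tsum_geometric_two']
  exact half_le_self ENNReal.toReal_nonneg

theorem rho_triangle {R : ℝ} (hR : 0 ≤ R) {P P' P'' : Set MMClass} (hP : IsPyramid P)
    (hP' : IsPyramid P') (hP'' : IsPyramid P'') : rho R P P'' ≤ rho R P P' + rho R P' P'' := by
  rw [rho, rho, rho, ← (summable_rhoTerm hR hP hP').tsum_add (summable_rhoTerm hR hP' hP'')]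
  refine (summable_rhoTerm hR hP hP'').tsum_le_tsum (fun n => ?_)
    ((summable_rhoTerm hR hP hP').add (summable_rhoTerm hR hP' hP''))
  rw [rhoTerm, rhoTerm, rhoTerm, ← mul_add]
  exact mul_le_mul_of_nonneg_left (Metric.hausdorffDist_triangle
    (hausdorffEDist_measurementBall_ne_top hP hP' _ (by positivity))) (by positivity)

theorem rho_comm (R : ℝ) (P P' : Set MMClass) : rho R P P' = rho R P' P := by
  simp only [rho, rhoTerm, measurementDist, Metric.hausdorffDist_comm]

theorem rho_self (R : ℝ) (P : Set MMClass) : rho R P P = 0 := by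
  simp [rho, rhoTerm, measurementDist]

theorem subset_of_rho_eq_zero {R : ℝ} (hR : 0 < R) {P P' : Set MMClass} (hP : IsPyramid P)
    (hP' : IsPyramid P') (h : rho R P P' = 0) : P ⊆ P' := by
  intro x hx
  obtain ⟨X, rfl⟩ := exists_cls_eq x
  refine cls_mem_of_law_mem hP' X hR fun n F hF hFR => ?_
  have h0 : measurementDist P P' (n + 1) ((n + 1 : ℕ) * R) = 0 :=
    le_antisymm (by simpa [h] using measurementDist_le_rho hR.le hP hP' (n + 1))
      (measurementDist_nonneg _ _ _ _)
  have heq := ((isClosed_measurementBall hP _ _).hausdorffDist_zero_iff_eq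
    (isClosed_measurementBall hP' _ _)
    (hausdorffEDist_measurementBall_ne_top hP hP' _ (by positivity))).1 h0
  exact heq ▸ law_mem_measurementBall hP.lower hx hF hFR

/-- `ρ_R` as a metric on the set of pyramids. -/
@[reducible]
def rhoMetricSpace {R : ℝ} (hR : 0 < R) : MetricSpace Pyramid where
  dist P P' := rho R P.1 P'.1
  dist_self P := rho_self R P.1
  dist_comm P P' := rho_comm R P.1 P'.1
  dist_triangle P P' P'' := rho_triangle hR.le P.2 P'.2 P''.2
  eq_of_dist_eq_zero {P P'} h := Subtype.ext
    ((subset_of_rho_eq_zero hR P.2 P'.2 h).antisymm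
      (subset_of_rho_eq_zero hR P'.2 P.2 (rho_comm R P.1 P'.1 ▸ h)))

/-! ### Weak convergence -/

/-- `ρ_R`-convergence is convergence of all measurements: the terms of the series are dominated
by a geometric sequence. -/
theorem tendsto_rho_iff {R : ℝ} (hR : 0 ≤ R) (Ps : ℕ → Pyramid) (P : Pyramid) :
    Tendsto (fun n => rho R (Ps n).1 P.1) atTop (𝓝 0) ↔
      ∀ k : ℕ, Tendsto (fun n => measurementDist (Ps n).1 P.1 (k + 1) ((k + 1 : ℕ) * R))
        atTop (𝓝 0) := by
  constructor
  · intro h k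
    refine squeeze_zero (fun n => measurementDist_nonneg _ _ _ _)
      (fun n => measurementDist_le_rho hR (Ps n).2 P.2 (k + 1)) ?_
    simpa using h.const_mul (((k + 1 : ℕ) : ℝ) * 2 ^ (k + 1 + 1))
  · intro h
    have := tendsto_tsum_of_dominated_convergence (𝓕 := atTop)
      (f := fun n k => rhoTerm R (Ps n).1 P.1 (k + 1)) (g := fun _ => 0)
      (summable_geometric_two' (1 / 2)) (fun k => by
        simpa [rhoTerm] using (h k).const_mul (1 / (((k + 1 : ℕ) : ℝ) * 2 ^ (k + 1 + 1))))
      (Eventually.of_forall fun n k => by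
        rw [Real.norm_of_nonneg (rhoTerm_nonneg _ _ _ _)]
        exact rhoTerm_le hR (Ps n).2 P.2 k)
    simpa [rho] using this

theorem liminf_boxTo_eq_zero {Ps : ℕ → Pyramid} {x : MMClass}
    (h : ∀ δ : ℝ≥0∞, 0 < δ → ∃ᶠ n in atTop, boxTo x (Ps n).1 ≤ δ) :
    liminf (fun n => boxTo x (Ps n).1) atTop = 0 :=
  le_antisymm (le_of_forall_gt_imp_ge_of_dense fun δ hδ =>
    liminf_le_of_frequently_le' (h δ hδ)) zero_le

theorem frequently_boxTo_lt {Ps : ℕ → Pyramid} {x : MMClass}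
    (h : liminf (fun n => boxTo x (Ps n).1) atTop = 0) {δ : ℝ≥0∞} (hδ : 0 < δ) :
    ∃ᶠ n in atTop, boxTo x (Ps n).1 < δ :=
  frequently_lt_of_liminf_lt (by isBoundedDefault) (h ▸ hδ)

/-- If the measurements converge, then every element of the limit pyramid is a box-limit: it is
box-close to one of its finite-dimensional laws and to measurements near that law. -/
theorem tendsto_boxTo_of_measurementDist {R : ℝ} (hR : 0 < R) {Ps : ℕ → Pyramid} {P : Pyramid}
    (h : ∀ k : ℕ, Tendsto (fun n => measurementDist (Ps n).1 P.1 (k + 1) ((k + 1 : ℕ) * R))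
      atTop (𝓝 0)) {x : MMClass} (hx : x ∈ P.1) :
    Tendsto (fun n => boxTo x (Ps n).1) atTop (𝓝 0) := by
  obtain ⟨X, rfl⟩ := exists_cls_eq x
  have key : ∀ ε : ℝ, 0 < ε → ∀ᶠ n in atTop, boxTo X.cls (Ps n).1 ≤ ENNReal.ofReal (4 * ε) := by
    intro ε hε
    obtain ⟨k, F, S, hF, hFR, hS, hm, hd⟩ := exists_lipschitz_almost_isometry X hR hε
    set μ := law X F hF.continuous.measurable
    have hμP : μ ∈ measurementBall P.1 (k + 1) ((k + 1 : ℕ) * R) :=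
      law_mem_measurementBall P.2.lower hx hF hFR
    have hnear : ∀ n, ∃ ν ∈ measurementBall (Ps n).1 (k + 1) ((k + 1 : ℕ) * R),
        dist ν μ < measurementDist (Ps n).1 P.1 (k + 1) ((k + 1 : ℕ) * R) + 1 / (n + 1 : ℝ) :=
      fun n => Metric.exists_dist_lt_of_hausdorffDist_lt' hμP
        (lt_add_of_pos_right _ (by positivity))
        (hausdorffEDist_measurementBall_ne_top (Ps n).2 P.2 _ (by positivity))
    choose ν hν hνd using hnear
    have hlim : Tendsto ν atTop (𝓝 μ) := tendsto_iff_dist_tendsto_zero.2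
      (squeeze_zero (fun _ => dist_nonneg) (fun n => (hνd n).le)
        (by simpa using (h k).add tendsto_one_div_add_atTop_nhds_zero_nat))
    filter_upwards [eventually_box_ofMeasure_le X hF.continuous.measurable hS hε hm hd
      (μ := μ.toMeasure) rfl (tendsto_toMeasure hlim)] with n hn
    exact (boxTo_le (hν n).1).trans hn
  refine ENNReal.tendsto_nhds_zero.2 fun δ hδ => ?_
  obtain ⟨ε, hε, hεδ⟩ := ENNReal.lt_iff_exists_nnreal_btwn.1 hδ
  have hε' : (0 : ℝ) < ε / 4 := div_pos (by exact_mod_cast hε) (by norm_num)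
  filter_upwards [key _ hε'] with n hn
  refine hn.trans (le_trans ?_ hεδ.le)
  rw [mul_div_cancel₀ _ (by norm_num), ENNReal.ofReal_coe_nnreal]

/-- If the measurements converge, then box-accumulation points of the sequence lie in the limit
pyramid: all their bounded laws are limits of measurements of the limit. -/
theorem mem_of_liminf_boxTo_eq_zero {R : ℝ} (hR : 0 < R) {Ps : ℕ → Pyramid} {P : Pyramid}
    (h : ∀ k : ℕ, Tendsto (fun n => measurementDist (Ps n).1 P.1 (k + 1) ((k + 1 : ℕ) * R))
      atTop (𝓝 0)) {x : MMClass} (hx : liminf (fun n => boxTo x (Ps n).1) atTop = 0) :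
    x ∈ P.1 := by
  obtain ⟨X, rfl⟩ := exists_cls_eq x
  refine cls_mem_of_law_mem P.2 X hR fun k F hF hFR => ?_
  rw [← (isClosed_measurementBall P.2 _ _).closure_eq, Metric.mem_closure_iff]
  intro ε hε
  have hev := (h k).eventually (gt_mem_nhds (half_pos hε))
  obtain ⟨n, hn, hnd⟩ := ((frequently_boxTo_lt hx
    (ENNReal.ofReal_pos.2 (half_pos hε))).and_eventually hev).exists
  obtain ⟨Y, hY, hXY⟩ := exists_box_lt hn
  obtain ⟨G, hG, hGR, hFG⟩ := exists_law_near_of_box_lt hXY hF (by positivity) hFR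
  obtain ⟨ν, hν, hνd⟩ := Metric.exists_dist_lt_of_hausdorffDist_lt
    (law_mem_measurementBall (Ps n).2.lower hY hG hGR) hnd
    (hausdorffEDist_measurementBall_ne_top (Ps n).2 P.2 _ (by positivity))
  refine ⟨ν, hν, (dist_triangle _ _ _).trans_lt
    ((add_lt_add_of_le_of_lt ?_ hνd).trans_eq (add_halves ε))⟩
  rw [edist_dist, ENNReal.ofReal_le_ofReal_iff (half_pos hε).le] at hFG
  exact hFG

/-- Under weak convergence the measurements of the limit are approximated, uniformly by total
boundedness, by those of the sequence. -/
theorem ConvergesWeakly.eventually_limit_near {Ps : ℕ → Pyramid} {P : Pyramid}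
    (h : ConvergesWeakly Ps P) (N : ℕ) {R : ℝ} (hR : 0 ≤ R) {ε : ℝ} (hε : 0 < ε) :
    ∀ᶠ n in atTop, ∀ μ ∈ measurementBall P.1 N R, ∃ ν ∈ measurementBall (Ps n).1 N R,
      dist μ ν ≤ ε := by
  have htb : TotallyBounded (measurementBall P.1 N R) :=
    (isCompact_ballMeasures N R).totallyBounded.subset Set.inter_subset_right
  obtain ⟨t, htP, htf, htc⟩ := Metric.finite_approx_of_totallyBounded htb (ε / 2) (half_pos hε)
  have hpt : ∀ μ ∈ t, ∀ᶠ n in atTop, ∃ ν ∈ measurementBall (Ps n).1 N R, dist μ ν ≤ ε / 2 := by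
    intro μ hμ
    obtain ⟨X, hX, F, hF, hFR, rfl⟩ := exists_law_of_mem_measurementBall (htP hμ)
    filter_upwards [(h.1 _ hX).eventually (gt_mem_nhds (ENNReal.ofReal_pos.2 (half_pos hε)))]
      with n hn
    obtain ⟨Y, hY, hXY⟩ := exists_box_lt hn
    obtain ⟨G, hG, hGR, hFG⟩ := exists_law_near_of_box_lt hXY hF hR hFR
    refine ⟨_, law_mem_measurementBall (Ps n).2.lower hY hG hGR, ?_⟩
    rwa [edist_dist, ENNReal.ofReal_le_ofReal_iff (half_pos hε).le] at hFG
  filter_upwards [(htf.eventually_all).2 hpt] with n hn μ hμ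
  obtain ⟨μ', hμ', hd⟩ := Set.mem_iUnion₂.1 (htc hμ)
  obtain ⟨ν, hν, hd'⟩ := hn μ' hμ'
  exact ⟨ν, hν, (dist_triangle μ μ' ν).trans
    ((add_le_add (Metric.mem_ball.1 hd).le hd').trans_eq (add_halves ε))⟩

/-- Under weak convergence the measurements of the sequence are uniformly close to those of the
limit: otherwise measurements that stay away would subconverge to a measurement outside the
limit pyramid. -/
theorem ConvergesWeakly.eventually_near_limit {Ps : ℕ → Pyramid} {P : Pyramid}
    (h : ConvergesWeakly Ps P) (N : ℕ) (R : ℝ) {ε : ℝ} (hε : 0 < ε) :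
    ∀ᶠ n in atTop, ∀ ν ∈ measurementBall (Ps n).1 N R, ∃ μ ∈ measurementBall P.1 N R,
      dist ν μ ≤ ε := by
  by_contra hcon
  obtain ⟨σ, hσ, hbad⟩ := extraction_of_frequently_atTop (not_eventually.1 hcon)
  push Not at hbad
  choose ν hν hfar using hbad
  obtain ⟨μ, hμ, τ, hτ, hlim⟩ := (isCompact_ballMeasures N R).tendsto_subseq fun n => (hν n).2
  have hμP : μ ∈ measurement P.1 N := by
    by_contra hμP
    refine (h.2 _ hμP).ne' (liminf_boxTo_eq_zero fun δ hδ => ?_)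
    obtain ⟨r, hr, hrδ⟩ := ENNReal.lt_iff_exists_nnreal_btwn.1 hδ
    have hr' : (0 : ℝ) < r / 4 := div_pos (by exact_mod_cast hr) (by norm_num)
    refine (hσ.comp hτ).tendsto_atTop.frequently (Eventually.frequently ?_)
    filter_upwards [tendsto_box_ofMeasure hlim hr'] with n hn
    refine (boxTo_le (hν (τ n)).1).trans (hn.trans (le_trans ?_ hrδ.le))
    rw [mul_div_cancel₀ _ (by norm_num), ENNReal.ofReal_coe_nnreal]
  obtain ⟨n, hn⟩ := (Metric.tendsto_nhds.1 hlim ε hε).exists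
  exact absurd (hfar (τ n) μ ⟨hμP, hμ⟩) (not_lt.2 hn.le)

theorem convergesWeakly_iff {R : ℝ} (hR : 0 < R) (Ps : ℕ → Pyramid) (P : Pyramid) :
    ConvergesWeakly Ps P ↔
      ∀ k : ℕ, Tendsto (fun n => measurementDist (Ps n).1 P.1 (k + 1) ((k + 1 : ℕ) * R))
        atTop (𝓝 0) := by
  constructor
  · intro h k
    rw [Metric.tendsto_nhds]
    intro ε hε
    have hkR : 0 ≤ ((k + 1 : ℕ) : ℝ) * R := by positivity
    filter_upwards [h.eventually_limit_near (k + 1) hkR (half_pos hε),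
      h.eventually_near_limit (k + 1) ((k + 1 : ℕ) * R) (half_pos hε)] with n h1 h2
    rw [Real.dist_0_eq_abs, abs_of_nonneg (measurementDist_nonneg _ _ _ _)]
    exact (Metric.hausdorffDist_le_of_mem_dist (half_pos hε).le h2 h1).trans_lt (half_lt_self hε)
  · exact fun h => ⟨fun x hx => tendsto_boxTo_of_measurementDist hR h hx, fun x hx =>
      pos_iff_ne_zero.2 fun h0 => hx (mem_of_liminf_boxTo_eq_zero hR h h0)⟩

end MM

end

theorem theorem3 :
    (∀ R : ℝ, 0 < R →
      (∀ P P' : MM.Pyramid, Summable fun n : ℕ => MM.rhoTerm R P.1 P'.1 (n + 1)) ∧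
      ∃ _ : MetricSpace MM.Pyramid,
        (∀ P P' : MM.Pyramid, dist P P' = MM.rho R P.1 P'.1) ∧
        ∀ (Ps : ℕ → MM.Pyramid) (P : MM.Pyramid),
          Tendsto Ps atTop (𝓝 P) ↔ MM.ConvergesWeakly Ps P) ∧
    (∀ (P P' : MM.Pyramid) (N : ℕ) (R : ℝ), 0 < R →
      MM.measurementDist P.1 P'.1 N (N * R) ≤ N * 2 ^ (N + 1) * MM.rho R P.1 P'.1) ∧
    (∀ (X Y : MM.MMSpace) (R : ℝ), 0 < R →
      ENNReal.ofReal (MM.rho R (MM.assoc X) (MM.assoc Y)) ≤ MM.dconc X Y) := by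
  refine ⟨fun R hR => ⟨fun P P' => MM.summable_rhoTerm hR.le P.2 P'.2,
    MM.rhoMetricSpace hR, fun _ _ => rfl, fun Ps P => ?_⟩,
    fun P P' N R hR => MM.measurementDist_le_rho hR.le P.2 P'.2 N,
    fun X Y R hR => MM.rho_assoc_le_dconc X Y hR.le⟩
  rw [MM.convergesWeakly_iff hR, ← MM.tendsto_rho_iff hR.le]
  let _ := MM.rhoMetricSpace hR
  exact tendsto_iff_dist_tendsto_zero
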